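/- Let $\alpha\in(0,2)$, let $\sigma$ be a non-zero finite measure on the unit sphere $S^0=\{-1,1\}$ of $\mathbb{R}$, and let $f:S^0\to\mathbb{R}$ satisfy $\max\{f(1),f(-1)\}<\alpha+1$. Let $\mu$ be an infinitely divisible probability measure on $\mathbb{R}$ without Gaussian component and with Lévy measure $$\nu(B)=\int_{S^0}\sigma(d\xi)\int_0^\infty \mathbf 1_B(r\xi)\,e^{rf(\xi)}(e^r-1)^{-(\alpha+1)}\,dr,\qquad B\in\mathcal{B}(\mathbb{R}\setminus\{0\}),$$ that is, for some $\theta\in\mathbb{R}$ and all $y\in\mathbb{R}$, $$\int_{\mathbb{R}} e^{iyx}\,\mu(dx)=\exp\Big(-iy\theta-\int_{\mathbb{R}\setminus\{0\}}\big(1-e^{iyx}+iyx\mathbf 1_{\{|x|<1\}}\big)\,\nu(dx)\Big).$$ (Such a $\mu$ is called a Lamperti stable distribution on $\mathbb{R}$.) Then $\mu$ has a density $p$ with respect to Lebesgue measure that is of class $C^\infty$, and for every integer $n\ge 0$ the derivative $p^{(n)}$ satisfies $p^{(n)}(x)\to 0$ as $|x|\to\infty$. -/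

import Mathlib

open MeasureTheory Filter Set
open scoped Topology ENNReal ContDiff RealInnerProductSpace

section LampertiStable

variable {E : Type*} [NormedAddCommGroup E] [InnerProductSpace ℝ E] [MeasurableSpace E]

/-- A probability measure `μ` is infinitely divisible if, for every `n ≥ 1`, it is the law of the
sum of `n` independent random vectors with a common law `ρ`. -/
def IsInfinitelyDivisible (μ : Measure E) : Prop :=
  IsProbabilityMeasure μ ∧ ∀ n : ℕ, 1 ≤ n →
    ∃ ρ : Measure E, IsProbabilityMeasure ρ ∧
      (Measure.pi (fun _ : Fin n => ρ)).map (fun x => ∑ i, x i) = μ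

/-- `ν` is a Lévy measure: it does not charge the origin and `∫ (1 ∧ ‖x‖²) ν(dx) < ∞`. -/
def IsLevyMeasure (ν : Measure E) : Prop :=
  ν {0} = 0 ∧ ∫⁻ x, ENNReal.ofReal (min 1 (‖x‖ ^ 2)) ∂ν < ⊤

open Classical in
/-- The characteristic exponent without Gaussian part, with linear term `θ` and Lévy measure `ν`:
`Ψ(y) = i⟨y, θ⟩ + ∫ (1 - e^{i⟨y, x⟩} + i⟨y, x⟩ 1_{‖x‖ < 1}) ν(dx)`. -/
noncomputable def levyExponent (θ : E) (ν : Measure E) (y : E) : ℂ :=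
  Complex.I * (⟪y, θ⟫ : ℝ) +
    ∫ x, (1 - Complex.exp (Complex.I * (⟪y, x⟫ : ℝ)) +
      if ‖x‖ < 1 then Complex.I * (⟪y, x⟫ : ℝ) else 0) ∂ν

/-- `μ` is infinitely divisible, has no Gaussian component, and `ν` is its Lévy measure. -/
def HasLevyMeasureNoGaussian (μ ν : Measure E) : Prop :=
  IsInfinitelyDivisible μ ∧ IsLevyMeasure ν ∧
    ∃ θ : E, ∀ y : E, charFun μ y = Complex.exp (-levyExponent θ ν y)

/-- The radial density `e^{r b} (e^r - 1)^{-(α + 1)}` (used for `r > 0` only). -/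
noncomputable def lampertiRadial (α b r : ℝ) : ℝ :=
  Real.exp (r * b) * (Real.exp r - 1) ^ (-(α + 1))

/-- The measure `σ(dξ) e^{r f(ξ)} (e^r - 1)^{-(α + 1)} dr` on pairs `(ξ, r)` with `ξ` in the unit
sphere and `r > 0`, transported to `E` by polar coordinates `(ξ, r) ↦ r ξ`. -/
noncomputable def lampertiLevyMeasure (α : ℝ) (f : Metric.sphere (0 : E) 1 → ℝ)
    (σ : Measure (Metric.sphere (0 : E) 1)) : Measure E :=
  ((σ.prod (volume.restrict (Ioi (0 : ℝ)))).withDensity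
      (fun p => ENNReal.ofReal (lampertiRadial α (f p.1) p.2))).map
    (fun p => p.2 • (p.1 : E))

/-- The polar form of the measure:
`ν(B) = ∫ σ(dξ) ∫_0^∞ 1_B(r ξ) e^{r f(ξ)} (e^r - 1)^{-(α + 1)} dr` for Borel sets `B`. -/
theorem lampertiLevyMeasure_apply [BorelSpace E] [SecondCountableTopology E]
    (α : ℝ) (f : Metric.sphere (0 : E) 1 → ℝ) (hf : Measurable f)
    (σ : Measure (Metric.sphere (0 : E) 1)) [IsFiniteMeasure σ]
    (B : Set E) (hB : MeasurableSet B) :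
    lampertiLevyMeasure α f σ B =
      ∫⁻ ξ, (∫⁻ r in Ioi (0 : ℝ), B.indicator 1 (r • (ξ : E)) *
        ENNReal.ofReal (Real.exp (r * f ξ) * (Real.exp r - 1) ^ (-(α + 1)))) ∂σ := by
  have hm : Measurable (fun p : Metric.sphere (0 : E) 1 × ℝ => p.2 • (p.1 : E)) := by fun_prop
  have hd : Measurable (fun p : Metric.sphere (0 : E) 1 × ℝ =>
      ENNReal.ofReal (lampertiRadial α (f p.1) p.2)) := by
    unfold lampertiRadial; fun_prop
  rw [lampertiLevyMeasure, Measure.map_apply hm hB, withDensity_apply _ (hm hB),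
    ← lintegral_indicator (hm hB), lintegral_prod _ (hd.indicator (hm hB)).aemeasurable]
  refine lintegral_congr fun ξ => lintegral_congr fun r => ?_
  by_cases h : r • (ξ : E) ∈ B <;> simp [indicator, h, lampertiRadial]

/-- The measure above is a Lévy measure as soon as `0 < α < 2` and `sup f < α + 1`. -/
theorem isLevyMeasure_lampertiLevyMeasure [BorelSpace E] [SecondCountableTopology E]
    (α : ℝ) (hα : α ∈ Ioo (0 : ℝ) 2) (f : Metric.sphere (0 : E) 1 → ℝ) (hf : Measurable f)
    (hb : BddAbove (range f)) (hs : (⨆ ξ, f ξ) < α + 1)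
    (σ : Measure (Metric.sphere (0 : E) 1)) [IsFiniteMeasure σ] :
    IsLevyMeasure (lampertiLevyMeasure α f σ) := by
  have hm : Measurable (fun p : Metric.sphere (0 : E) 1 × ℝ => p.2 • (p.1 : E)) := by fun_prop
  have hd : Measurable (fun p : Metric.sphere (0 : E) 1 × ℝ =>
      ENNReal.ofReal (lampertiRadial α (f p.1) p.2)) := by
    unfold lampertiRadial; fun_prop
  obtain ⟨h0, h2⟩ := hα
  constructor
  · rw [lampertiLevyMeasure_apply α f hf σ _ (measurableSet_singleton 0)]
    rw [lintegral_eq_zero_of_ae_eq_zero]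
    refine Eventually.of_forall fun ξ => ?_
    refine (setLIntegral_congr_fun measurableSet_Ioi (g := fun _ => 0) ?_).trans (by simp)
    intro r hr
    have hξ : (ξ : E) ≠ 0 := ne_zero_of_mem_unit_sphere ξ
    have hr' : r ≠ 0 := ne_of_gt hr
    simp [indicator, hξ, hr']
  · set g : ℝ := ⨆ ξ, f ξ with hg
    have hnm : Measurable (fun x : E => ENNReal.ofReal (min 1 (‖x‖ ^ 2))) := by fun_prop
    rw [lampertiLevyMeasure, lintegral_map hnm hm]
    change ∫⁻ p, ((fun x : E => ENNReal.ofReal (min 1 (‖x‖ ^ 2))) ∘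
      fun p : Metric.sphere (0 : E) 1 × ℝ => p.2 • (p.1 : E)) p ∂_ < ⊤
    rw [lintegral_withDensity_eq_lintegral_mul _ hd (hnm.comp hm),
      lintegral_prod _ ((hd.mul (hnm.comp hm)).aemeasurable)]
    let C : ℝ := (1 - Real.exp (-1)) ^ (-(α + 1))
    have hc : 0 < 1 - Real.exp (-1) := by
      have : Real.exp (-1) < 1 := by simp
      linarith
    let b : ℝ → ℝ := fun r => if r ≤ 1 then Real.exp |g| * r ^ (1 - α)
      else C * Real.exp (-(α + 1 - g) * r)
    have hbi : IntegrableOn b (Ioi 0) := by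
      rw [← Ioc_union_Ioi_eq_Ioi (zero_le_one' ℝ)]
      refine IntegrableOn.union ?_ ?_
      · have : IntegrableOn (fun r : ℝ => Real.exp |g| * r ^ (1 - α)) (Ioc 0 1) :=
          ((intervalIntegrable_iff_integrableOn_Ioc_of_le zero_le_one).1
            (intervalIntegral.intervalIntegrable_rpow' (by linarith))).const_mul _
        refine this.congr_fun (fun r hr => ?_) measurableSet_Ioc
        simp [b, hr.2]
      · have : IntegrableOn (fun r : ℝ => C * Real.exp (-(α + 1 - g) * r)) (Ioi 1) :=
          (exp_neg_integrableOn_Ioi 1 (by linarith)).const_mul _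
        refine this.congr_fun (fun r hr => ?_) measurableSet_Ioi
        simp [b, not_le.2 (mem_Ioi.1 hr)]
    have hbf : ∫⁻ r in Ioi (0 : ℝ), ENNReal.ofReal (b r) < ⊤ := hbi.lintegral_lt_top
    refine lt_of_le_of_lt (lintegral_mono (g := fun _ =>
      ∫⁻ r in Ioi (0 : ℝ), ENNReal.ofReal (b r)) fun ξ => ?_) ?_
    · refine setLIntegral_mono' measurableSet_Ioi fun r hr => ?_
      have hr : 0 < r := hr
      have hfg : f ξ ≤ g := le_ciSup hb ξ
      have hn : ‖r • (ξ : E)‖ = r := by simp [norm_smul, abs_of_pos hr]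
      have hpos : 0 < Real.exp r - 1 := by have := Real.add_one_lt_exp hr.ne'; linarith
      have hl : 0 ≤ lampertiRadial α (f ξ) r := by
        unfold lampertiRadial; positivity
      simp only [Pi.mul_apply, Function.comp_apply, hn]
      rw [← ENNReal.ofReal_mul hl]
      refine ENNReal.ofReal_le_ofReal ?_
      have he : Real.exp (r * f ξ) ≤ Real.exp (r * g) := by gcongr
      by_cases h1 : r ≤ 1
      · simp only [b, h1, if_true]
        have e1 : Real.exp (r * f ξ) ≤ Real.exp |g| := he.trans <| by
          apply Real.exp_le_exp.2
          calc r * g ≤ r * |g| := by gcongr; exact le_abs_self g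
            _ ≤ 1 * |g| := by gcongr
            _ = |g| := one_mul _
        have e2 : (Real.exp r - 1) ^ (-(α + 1)) ≤ r ^ (-(α + 1)) :=
          Real.rpow_le_rpow_of_nonpos hr (by have := Real.add_one_le_exp r; linarith)
            (by linarith)
        have e3 : r ^ (1 - α) = r ^ (-(α + 1)) * r ^ 2 := by
          rw [← Real.rpow_natCast r 2, ← Real.rpow_add hr]; congr 1; push_cast; ring
        rw [e3, lampertiRadial, ← mul_assoc]
        gcongr
        exact min_le_right _ _
      · simp only [b, h1, if_false]
        have h1 : 1 < r := not_le.1 h1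
        have e2 : (Real.exp r - 1) ^ (-(α + 1)) ≤
            (Real.exp r * (1 - Real.exp (-1))) ^ (-(α + 1)) := by
          refine Real.rpow_le_rpow_of_nonpos (by positivity) ?_ (by linarith)
          have : 1 ≤ Real.exp r * Real.exp (-1) := by
            rw [← Real.exp_add]; exact Real.one_le_exp (by linarith)
          linarith
        rw [Real.mul_rpow (Real.exp_pos r).le hc.le, ← Real.exp_mul] at e2
        have e3 : Real.exp (-(α + 1 - g) * r) = Real.exp (r * g) * Real.exp (r * -(α + 1)) := by
          rw [← Real.exp_add]; congr 1; ring
        calc lampertiRadial α (f ξ) r * min 1 (r ^ 2) ≤ lampertiRadial α (f ξ) r * 1 := by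
              gcongr; exact min_le_left _ _
          _ ≤ Real.exp (r * g) * (Real.exp (r * -(α + 1)) * C) := by
              rw [mul_one, lampertiRadial]; gcongr
          _ = C * Real.exp (-(α + 1 - g) * r) := by rw [e3]; ring
    · rw [lintegral_const]
      exact ENNReal.mul_lt_top hbf (measure_lt_top σ _)

/-- `μ` is a Lamperti stable distribution on `E` with index `α`, function `f` and spherical
measure `σ`. -/
structure IsLampertiStable (α : ℝ) (f : Metric.sphere (0 : E) 1 → ℝ)
    (σ : Measure (Metric.sphere (0 : E) 1)) (μ : Measure E) : Prop where
  index_mem : α ∈ Ioo (0 : ℝ) 2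
  measurable : Measurable f
  bddAbove : BddAbove (range f)
  iSup_lt : (⨆ ξ, f ξ) < α + 1
  finite : IsFiniteMeasure σ
  ne_zero : σ ≠ 0
  levy : HasLevyMeasureNoGaussian μ (lampertiLevyMeasure α f σ)

end LampertiStable

/-!
The characteristic function `φ` of a Lamperti stable law decays faster than every polynomial, and
Fourier inversion then gives a smooth density all of whose derivatives vanish at infinity.

*Decay.* We have `|φ y| = exp (-∫ (1 - cos (y x)) ν(dx))`. On the shell `1/2 ≤ |y x| ≤ 1` the
integrand is at least `1/20`, so the exponent is at least `ν {x | 1/2 ≤ |y x| ≤ 1} / 20`. Near the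
origin the radial density of `ν` is comparable to `r ^ (-(α + 1))`, hence for `|y| ≥ 1` the shell
has mass at least `c |y| ^ α` (`exists_le_lampertiLevyMeasure`). This yields
`|φ y| ≤ C exp (-c |y| ^ α)` (`IsLampertiStable.exists_norm_charFun_le`).

*Inversion.* The candidate density is the real part of `F = 𝓕 (t ↦ φ (2 π t))`. Fubini's theorem
shows that `∫ g ∂μ = ∫ g F` for every Schwartz function `g`
(`integral_schwartz_eq_integral_mul_fourier_charFun`). Bump functions converging to the indicator
of a compact interval turn this into `μ [a, b] = ∫_a^b Re F`, which gives both the nonnegativity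
of `Re F` and the identity `μ = Re F dx` (`eq_withDensity_re_fourier_charFun`).

*Regularity.* Every `t ^ n φ (2 π t)` is integrable, so `F` is smooth, and its derivatives are
Fourier transforms of integrable functions, which tend to zero by the Riemann-Lebesgue lemma
(`contDiff_re_fourier_and_tendsto`).
-/

/-! ### Fourier inversion for finite measures -/

open FourierTransform in
/-- Fourier inversion of a finite measure, tested against Schwartz functions. Writing `g = 𝓕 h`,
both sides equal `∫ h (-t) φ (2 π t) dt`, where `φ` is the characteristic function. -/
theorem integral_schwartz_eq_integral_mul_fourier_charFun (μ : Measure ℝ) [IsFiniteMeasure μ]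
    (hG : Integrable (fun t : ℝ => charFun μ (2 * Real.pi * t))) (g : SchwartzMap ℝ ℂ) :
    ∫ x, g x ∂μ = ∫ x, g x * 𝓕 (fun t : ℝ => charFun μ (2 * Real.pi * t)) x := by
  set G : ℝ → ℂ := fun t => charFun μ (2 * Real.pi * t) with hGdef
  obtain ⟨h, rfl⟩ : ∃ h : SchwartzMap ℝ ℂ, 𝓕 h = g :=
    ⟨𝓕⁻ g, FourierTransform.fourier_fourierInv_eq g⟩
  -- On the Lebesgue side, exchange and undo the Fourier transform of `𝓕 h`.
  have hR : ∫ x, (𝓕 h : SchwartzMap ℝ ℂ) x * 𝓕 G x = ∫ t, h (-t) * G t := by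
    have key := VectorFourier.integral_fourierIntegral_smul_eq_flip (𝕜 := ℝ) (μ := volume)
      (ν := volume) (e := Real.fourierChar) (L := innerₗ ℝ)
      (f := (𝓕 h : SchwartzMap ℝ ℂ)) (g := G)
      Real.continuous_fourierChar continuous_inner (𝓕 h : SchwartzMap ℝ ℂ).integrable hG
    rw [flip_innerₗ] at key
    refine Eq.trans key.symm ?_
    refine integral_congr_ae (Eventually.of_forall fun t => ?_)
    change 𝓕 (⇑(𝓕 h : SchwartzMap ℝ ℂ)) t * G t = _
    congr 1
    have h1 : 𝓕⁻ (⇑(𝓕 h : SchwartzMap ℝ ℂ)) (-t) = h (-t) := by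
      rw [← SchwartzMap.fourierInv_coe, FourierTransform.fourierInv_fourier_eq]
    rw [← h1, Real.fourierInv_eq_fourier_neg, neg_neg]
  -- On the side of `μ`, the constant function `1` has Fourier integral `φ (-2 π ·)`.
  have hLft : ∫ x, (𝓕 h : SchwartzMap ℝ ℂ) x ∂μ = ∫ t, h t * G (-t) := by
    have key := VectorFourier.integral_fourierIntegral_smul_eq_flip (𝕜 := ℝ) (μ := μ)
      (ν := volume) (e := Real.fourierChar) (L := innerₗ ℝ)
      (f := fun _ => (1 : ℂ)) (g := ⇑h)
      Real.continuous_fourierChar continuous_inner (integrable_const _) h.integrable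
    rw [flip_innerₗ] at key
    simp only [one_smul] at key
    rw [SchwartzMap.fourier_coe]
    refine Eq.trans key.symm ?_
    refine integral_congr_ae (Eventually.of_forall fun t => ?_)
    simp only [smul_eq_mul]
    rw [mul_comm]
    congr 1
    simp only [hGdef]
    rw [charFun_eq_fourierIntegral']
    have : -(2 * Real.pi)⁻¹ • (2 * Real.pi * -t) = t := by
      have := Real.pi_ne_zero
      simp; field_simp
    rw [this]; rfl
  rw [hLft, hR, ← integral_neg_eq_self (fun t => h (-t) * G t)]
  simp

/-- Smooth bump functions, supported in a common ball, that converge pointwise to the indicator of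
a closed ball (possibly reduced to a point). -/
theorem tendsto_bump_indicator (c r : ℝ) (hr : 0 ≤ r) :
    ∃ g : ℕ → ContDiffBump c, (∀ n x, x ∉ Metric.closedBall c (r + 2) → g n x = 0) ∧
      ∀ x, Tendsto (fun n => g n x) atTop (𝓝 ((Metric.closedBall c r).indicator 1 x)) := by
  have hpos (n : ℕ) : (0 : ℝ) < 1 / (n + 1) := Nat.one_div_pos_of_nat
  -- The inner radius exceeds `r` because a bump function needs a positive one, even if `r = 0`.
  refine ⟨fun n => ⟨r + 1 / (n + 1), r + 2 * (1 / (n + 1)), by linarith [hpos n],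
    by linarith [hpos n]⟩, fun n x hx => ?_, fun x => ?_⟩
  · apply ContDiffBump.zero_of_le_dist
    rw [Metric.mem_closedBall, not_le] at hx
    have : (1 : ℝ) / (n + 1) ≤ 1 := by
      rw [div_le_one (by positivity)]; linarith [Nat.cast_nonneg (α := ℝ) n]
    simp only; linarith
  · by_cases hx : x ∈ Metric.closedBall c r
    · rw [indicator_of_mem hx]
      refine tendsto_const_nhds.congr fun n => ?_
      refine (ContDiffBump.one_of_mem_closedBall _ ?_).symm
      exact Metric.closedBall_subset_closedBall (by linarith [hpos n]) hx
    · rw [indicator_of_notMem hx]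
      refine tendsto_const_nhds.congr' ?_
      have ht : Tendsto (fun n : ℕ => r + 2 * ((1 : ℝ) / (n + 1))) atTop (𝓝 (r + 2 * 0)) :=
        (tendsto_one_div_add_atTop_nhds_zero_nat.const_mul 2).const_add r
      rw [Metric.mem_closedBall, not_le] at hx
      filter_upwards [ht.eventually_lt_const (by simpa using hx)] with n hn
      exact (ContDiffBump.zero_of_le_dist _ hn.le).symm

theorem measureReal_Icc_eq_of_integral_schwartz (μ : Measure ℝ) [IsFiniteMeasure μ] (F : ℝ → ℂ)
    (hF : Continuous F) (h : ∀ g : SchwartzMap ℝ ℂ, ∫ x, g x ∂μ = ∫ x, g x * F x)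
    {a b : ℝ} (hab : a ≤ b) : μ.real (Icc a b) = ∫ x in Icc a b, (F x).re := by
  obtain ⟨g, hg0, hg⟩ := tendsto_bump_indicator ((a + b) / 2) ((b - a) / 2) (by linarith)
  have hball : Metric.closedBall ((a + b) / 2) ((b - a) / 2) = Icc a b := by
    rw [Real.closedBall_eq_Icc]; congr 1 <;> ring
  rw [hball] at hg
  set K := Metric.closedBall ((a + b) / 2) ((b - a) / 2 + 2)
  have hK : IsCompact K := isCompact_closedBall _ _
  have hp : Continuous fun x => (F x).re := Complex.continuous_re.comp hF
  have hgn (n : ℕ) (x : ℝ) : ‖g n x‖ ≤ 1 := by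
    rw [Real.norm_of_nonneg (g n).nonneg]; exact (g n).le_one
  have hgF (n : ℕ) : ∫ x, g n x ∂μ = ∫ x, g n x * (F x).re := by
    have hc : HasCompactSupport (fun x => (g n x : ℂ)) :=
      (g n).hasCompactSupport.comp_left (g := fun x : ℝ => (x : ℂ)) (by simp)
    have hs : ContDiff ℝ ∞ (fun x => (g n x : ℂ)) :=
      Complex.ofRealCLM.contDiff.comp (g n).contDiff
    have key := h (hc.toSchwartzMap hs)
    simp only [HasCompactSupport.toSchwartzMap_toFun] at key
    have hi : Integrable (fun x => (g n x : ℂ) * F x) :=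
      Continuous.integrable_of_hasCompactSupport (hs.continuous.mul hF) hc.mul_right
    have key2 := congrArg Complex.re key
    rw [integral_complex_ofReal, Complex.ofReal_re] at key2
    rw [key2]
    refine Eq.trans (Complex.reCLM.integral_comp_comm hi).symm ?_
    simp
  have h1 : Tendsto (fun n => ∫ x, g n x ∂μ) atTop (𝓝 (∫ x, (Icc a b).indicator 1 x ∂μ)) := by
    refine tendsto_integral_of_dominated_convergence (fun _ => 1)
      (fun n => (g n).continuous.aestronglyMeasurable) (integrable_const _)
      (fun n => Eventually.of_forall (hgn n)) (Eventually.of_forall hg)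
  have h2 : Tendsto (fun n => ∫ x, g n x * (F x).re) atTop
      (𝓝 (∫ x, (Icc a b).indicator 1 x * (F x).re)) := by
    refine tendsto_integral_of_dominated_convergence (K.indicator fun x => ‖(F x).re‖)
      (fun n => ((g n).continuous.mul hp).aestronglyMeasurable)
      ((hp.norm.continuousOn.integrableOn_compact hK).integrable_indicator hK.measurableSet)
      (fun n => Eventually.of_forall fun x => ?_)
      (Eventually.of_forall fun x => (hg x).mul_const _)
    by_cases hx : x ∈ K
    · rw [indicator_of_mem hx, norm_mul]
      exact mul_le_of_le_one_left (norm_nonneg _) (hgn n x)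
    · simp [indicator_of_notMem hx, hg0 n x hx]
  simp only [hgF] at h1
  have := tendsto_nhds_unique h1 h2
  rw [integral_indicator_one measurableSet_Icc] at this
  rw [this, ← integral_indicator measurableSet_Icc]
  refine integral_congr_ae (Eventually.of_forall fun x => ?_)
  by_cases hx : x ∈ Icc a b <;> simp [hx]

theorem nonneg_of_setIntegral_Icc_nonneg {p : ℝ → ℝ} (hp : Continuous p)
    (h : ∀ a b, a ≤ b → 0 ≤ ∫ x in Icc a b, p x) (x : ℝ) : 0 ≤ p x := by
  have hmono : Monotone fun b => ∫ t in (0 : ℝ)..b, p t := by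
    intro a b hab
    rw [← sub_nonneg, intervalIntegral.integral_interval_sub_left (hp.intervalIntegrable _ _)
      (hp.intervalIntegrable _ _), intervalIntegral.integral_of_le hab,
      ← integral_Icc_eq_integral_Ioc]
    exact h a b hab
  rw [← hp.deriv_integral p 0 x]
  exact hmono.deriv_nonneg

open FourierTransform in
/-- A finite measure with integrable characteristic function has a continuous density, namely its
inverse Fourier transform. Taking real parts avoids having to show that the transform is real. -/
theorem eq_withDensity_re_fourier_charFun (μ : Measure ℝ) [IsFiniteMeasure μ]
    (hG : Integrable (fun t : ℝ => charFun μ (2 * Real.pi * t))) :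
    (∀ x, 0 ≤ (𝓕 (fun t : ℝ => charFun μ (2 * Real.pi * t)) x).re) ∧
    μ = volume.withDensity
      (fun x => ENNReal.ofReal (𝓕 (fun t : ℝ => charFun μ (2 * Real.pi * t)) x).re) := by
  have hF : Continuous (𝓕 (fun t : ℝ => charFun μ (2 * Real.pi * t))) :=
    VectorFourier.fourierIntegral_continuous Real.continuous_fourierChar continuous_inner hG
  have hp := Complex.continuous_re.comp hF
  have hI {a b : ℝ} (hab : a ≤ b) := measureReal_Icc_eq_of_integral_schwartz μ _ hF
    (integral_schwartz_eq_integral_mul_fourier_charFun μ hG) hab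
  have h0 : ∀ x, 0 ≤ (𝓕 (fun t : ℝ => charFun μ (2 * Real.pi * t)) x).re :=
    nonneg_of_setIntegral_Icc_nonneg hp fun a b hab => by
    rw [← hI hab]
    exact measureReal_nonneg
  refine ⟨h0, Measure.ext_of_Icc _ _ fun a b hab => ?_⟩
  have hi : IntegrableOn (fun x => (𝓕 (fun t : ℝ => charFun μ (2 * Real.pi * t)) x).re)
      (Icc a b) := hp.continuousOn.integrableOn_compact isCompact_Icc
  rw [withDensity_apply _ measurableSet_Icc,
    ← ofReal_integral_eq_lintegral_ofReal hi (Eventually.of_forall h0), ← hI hab,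
    ofReal_measureReal]

/-! ### The real part of the characteristic exponent -/

theorem Complex.norm_exp_I_mul_sub_one_sub_le (u : ℝ) :
    ‖Complex.exp (Complex.I * u) - 1 - Complex.I * u‖ ≤ 3 * u ^ 2 := by
  have hn : ‖Complex.I * (u : ℂ)‖ = |u| := by simp
  rcases le_total |u| 1 with h | h
  · refine (Complex.norm_exp_sub_one_sub_id_le (hn.trans_le h)).trans ?_
    rw [hn, sq_abs]; nlinarith [sq_nonneg u]
  · have h1 : ‖Complex.exp (Complex.I * u)‖ = 1 := by
      rw [mul_comm]; exact Complex.norm_exp_ofReal_mul_I u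
    calc _ ≤ ‖Complex.exp (Complex.I * u)‖ + ‖(1 : ℂ)‖ + ‖Complex.I * (u : ℂ)‖ :=
          (norm_sub_le _ _).trans (by gcongr; exact norm_sub_le _ _)
      _ = 1 + 1 + |u| := by rw [h1, hn, norm_one]
      _ ≤ 3 * |u| ^ 2 := by nlinarith
      _ = 3 * u ^ 2 := by rw [sq_abs]

open Classical in
/-- The integrand of the Lévy exponent is `O (1 ∧ x ^ 2)`. Without this, the Bochner integral in
`levyExponent` could take its default value `0`. -/
theorem IsLevyMeasure.integrable_levyExponent {ν : Measure ℝ} (hν : IsLevyMeasure ν) (y : ℝ) :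
    Integrable (fun x : ℝ => 1 - Complex.exp (Complex.I * (⟪y, x⟫ : ℝ)) +
      if ‖x‖ < 1 then Complex.I * (⟪y, x⟫ : ℝ) else 0) ν := by
  have hm : Measurable (fun x : ℝ => 1 - Complex.exp (Complex.I * (⟪y, x⟫ : ℝ)) +
      if ‖x‖ < 1 then Complex.I * (⟪y, x⟫ : ℝ) else 0) := by
    refine Measurable.add (by fun_prop) (Measurable.ite ?_ (by fun_prop) measurable_const)
    exact measurableSet_lt measurable_norm measurable_const
  have hi : Integrable (fun x : ℝ => min 1 (‖x‖ ^ 2)) ν :=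
    ⟨by fun_prop, by
      rw [hasFiniteIntegral_iff_ofReal (Eventually.of_forall fun x => by positivity)]
      exact hν.2⟩
  refine (hi.const_mul (2 + 3 * y ^ 2)).mono' hm.aestronglyMeasurable
    (Eventually.of_forall fun x => ?_)
  have hin : (⟪y, x⟫ : ℝ) = x * y := by simp
  by_cases hx : ‖x‖ < 1
  · have h1 : ‖x‖ ^ 2 ≤ 1 := by nlinarith [norm_nonneg x]
    rw [if_pos hx, min_eq_right h1, ← norm_neg]
    have := Complex.norm_exp_I_mul_sub_one_sub_le ⟪y, x⟫
    refine le_trans (le_of_eq ?_) (this.trans ?_)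
    · congr 1; ring
    · rw [hin, Real.norm_eq_abs, sq_abs]; nlinarith [sq_nonneg x]
  · have h1 : 1 ≤ ‖x‖ ^ 2 := by nlinarith [not_lt.1 hx]
    rw [if_neg hx, min_eq_left h1, add_zero]
    have h2 : ‖Complex.exp (Complex.I * (⟪y, x⟫ : ℝ))‖ = 1 := by
      rw [mul_comm]; exact Complex.norm_exp_ofReal_mul_I _
    refine (norm_sub_le _ _).trans ?_
    rw [h2, norm_one]; nlinarith [sq_nonneg y]

open Classical in
theorem re_levyExponent_integrand (y x : ℝ) :
    (1 - Complex.exp (Complex.I * (⟪y, x⟫ : ℝ)) +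
      if ‖x‖ < 1 then Complex.I * (⟪y, x⟫ : ℝ) else 0).re = 1 - Real.cos (y * x) := by
  have h : (Complex.exp (Complex.I * ((⟪y, x⟫ : ℝ) : ℂ))).re = Real.cos (y * x) := by
    rw [mul_comm, Complex.exp_ofReal_mul_I_re]
    simp [mul_comm]
  rw [Complex.add_re, Complex.sub_re, h, Complex.one_re]
  split_ifs <;> simp

theorem IsLevyMeasure.integrable_one_sub_cos {ν : Measure ℝ} (hν : IsLevyMeasure ν) (y : ℝ) :
    Integrable (fun x => 1 - Real.cos (y * x)) ν :=
  (hν.integrable_levyExponent y).re.congr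
    (Eventually.of_forall (re_levyExponent_integrand y))

theorem IsLevyMeasure.re_levyExponent {ν : Measure ℝ} (hν : IsLevyMeasure ν) (θ y : ℝ) :
    (levyExponent θ ν y).re = ∫ x, (1 - Real.cos (y * x)) ∂ν := by
  have h0 (u : ℝ) : (Complex.I * (u : ℂ)).re = 0 := by simp
  rw [levyExponent, Complex.add_re, h0, zero_add]
  exact (Complex.reCLM.integral_comp_comm (hν.integrable_levyExponent y)).symm.trans
    (integral_congr_ae (Eventually.of_forall (re_levyExponent_integrand y)))

theorem one_div_twenty_le_one_sub_cos {u : ℝ} (h₁ : 1 / 2 ≤ |u|) (h₂ : |u| ≤ 1) :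
    1 / 20 ≤ 1 - Real.cos u := by
  have hpi := Real.pi_lt_d2
  have hpi3 := Real.pi_gt_three
  have h := Real.cos_le_one_sub_mul_cos_sq (h₂.trans (by linarith))
  have hu : 1 / 4 ≤ u ^ 2 := by rw [← sq_abs]; nlinarith
  have h5 : 1 / 5 ≤ 2 / Real.pi ^ 2 := by
    rw [div_le_div_iff₀ (by norm_num) (by positivity)]; nlinarith
  nlinarith

/-- Markov's inequality for `1 - cos (y x)`: the Lévy mass of the shell where `|y x|` is of order
one bounds the real part of the exponent from below. -/
theorem IsLevyMeasure.measure_le_re_levyExponent {ν : Measure ℝ} (hν : IsLevyMeasure ν)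
    (θ y : ℝ) : ν {x | 1 / 2 ≤ |y * x| ∧ |y * x| ≤ 1} ≤
      ENNReal.ofReal (20 * (levyExponent θ ν y).re) := by
  have hi := hν.integrable_one_sub_cos y
  have h0 : ∀ x, 0 ≤ 1 - Real.cos (y * x) := fun x => by linarith [Real.cos_le_one (y * x)]
  have h := mul_meas_ge_le_integral_of_nonneg (Eventually.of_forall h0) hi (1 / 20)
  have hfin := hi.measure_ge_lt_top (ε := 1 / 20) (by norm_num)
  refine (measure_mono (t := {x | 1 / 20 ≤ 1 - Real.cos (y * x)})
    fun x hx => one_div_twenty_le_one_sub_cos hx.1 hx.2).trans ?_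
  rw [← ofReal_measureReal hfin.ne, hν.re_levyExponent]
  exact ENNReal.ofReal_le_ofReal (by linarith)

theorem finite_sphere_real : Finite (Metric.sphere (0 : ℝ) 1) := by
  refine Set.Finite.subset (s := {1, -1}) (by simp) fun x hx => ?_
  have : |x| = 1 := by simpa using hx
  exact eq_or_eq_neg_of_abs_eq this

/-- For `r ≤ 1 / s ≤ 1` we have `e ^ r - 1 ≤ 2 r ≤ 2 / s`, so that the radial density is at least
of order `s ^ (α + 1)`. -/
theorem lampertiRadial_lower_bound {α b m r s : ℝ} (hα : 0 < α) (hm : 0 ≤ m) (hb : -m ≤ b)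
    (hs : 1 ≤ s) (hr : 0 < r) (hrs : r ≤ 1 / s) :
    Real.exp (-m) * (2 / s) ^ (-(α + 1)) ≤ lampertiRadial α b r := by
  have hs0 : 0 < s := by linarith
  have hr1 : r ≤ 1 := hrs.trans (by rw [div_le_one hs0]; exact hs)
  have hpos : 0 < Real.exp r - 1 := by have := Real.add_one_lt_exp hr.ne'; linarith
  have hexp : Real.exp r - 1 ≤ 2 / s := by
    have h1 := Real.abs_exp_sub_one_le (x := r) (by rw [abs_of_pos hr]; exact hr1)
    rw [abs_of_pos hpos, abs_of_pos hr] at h1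
    calc _ ≤ 2 * r := h1
      _ ≤ 2 * (1 / s) := by gcongr
      _ = 2 / s := by ring
  unfold lampertiRadial
  gcongr ?_ * ?_
  · apply Real.exp_le_exp.2; nlinarith
  · exact Real.rpow_le_rpow_of_nonpos hpos hexp (by linarith)

/-- The shell `1 / (2 |y|) ≤ |x| ≤ 1 / |y|` has Lévy mass at least of order `|y| ^ α`: its radial
length is `1 / (2 |y|)` and the radial density there is at least of order `|y| ^ (α + 1)`. -/
theorem exists_le_lampertiLevyMeasure (α : ℝ) (hα : 0 < α) (f : Metric.sphere (0 : ℝ) 1 → ℝ)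
    (hf : Measurable f) (σ : Measure (Metric.sphere (0 : ℝ) 1)) [IsFiniteMeasure σ] (hσ : σ ≠ 0) :
    ∃ c : ℝ, 0 < c ∧ ∀ y : ℝ, 1 ≤ |y| → ENNReal.ofReal (c * |y| ^ α) ≤
      lampertiLevyMeasure α f σ {x | 1 / 2 ≤ |y * x| ∧ |y * x| ≤ 1} := by
  -- Only an upper bound of `f` is assumed; the lower bound comes from the finiteness of the sphere.
  have := finite_sphere_real
  obtain ⟨b, hb⟩ := (Set.toFinite (range f)).bddBelow
  have hbm (ξ) : -|b| ≤ f ξ := (neg_abs_le b).trans (hb ⟨ξ, rfl⟩)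
  have hσ0 : 0 < σ.real univ := by
    rw [measureReal_def, ENNReal.toReal_pos_iff]
    exact ⟨by simpa [pos_iff_ne_zero] using hσ, measure_lt_top σ _⟩
  refine ⟨Real.exp (-|b|) * 2 ^ (-(α + 2)) * σ.real univ, by positivity, fun y hy => ?_⟩
  set s := |y| with hs
  have hs0 : 0 < s := by linarith
  set K := Real.exp (-|b|) * (2 / s) ^ (-(α + 1)) with hK
  have hK0 : 0 ≤ K := by positivity
  have hA : MeasurableSet {x : ℝ | 1 / 2 ≤ |y * x| ∧ |y * x| ≤ 1} :=
    (by fun_prop : Measurable fun x : ℝ => |y * x|) measurableSet_Icc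
  rw [lampertiLevyMeasure_apply α f hf σ _ hA]
  have hconst : Real.exp (-|b|) * 2 ^ (-(α + 2)) * σ.real univ * s ^ α =
      K * (1 / s - 1 / (2 * s)) * σ.real univ := by
    rw [hK, Real.div_rpow (by norm_num) hs0.le, Real.rpow_neg hs0.le (α + 1),
      Real.rpow_add hs0, Real.rpow_one, show -(α + 2) = -(α + 1) + -1 by ring,
      Real.rpow_add (by norm_num : (0 : ℝ) < 2), Real.rpow_neg_one]
    field_simp
    ring
  rw [hconst, ENNReal.ofReal_mul' hσ0.le, ofReal_measureReal, ← lintegral_const]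
  refine lintegral_mono fun ξ => ?_
  have hsub : Icc (1 / (2 * s)) (1 / s) ⊆ Ioi 0 := fun r hr =>
    lt_of_lt_of_le (by positivity) hr.1
  calc ENNReal.ofReal (K * (1 / s - 1 / (2 * s)))
      = ∫⁻ r in Icc (1 / (2 * s)) (1 / s), ENNReal.ofReal K := by
        rw [setLIntegral_const, Real.volume_Icc, ENNReal.ofReal_mul hK0]
    _ ≤ ∫⁻ r in Icc (1 / (2 * s)) (1 / s),
        {x | 1 / 2 ≤ |y * x| ∧ |y * x| ≤ 1}.indicator 1 (r • (ξ : ℝ)) *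
        ENNReal.ofReal (Real.exp (r * f ξ) * (Real.exp r - 1) ^ (-(α + 1))) := by
        refine setLIntegral_mono' measurableSet_Icc fun r hr => ?_
        have hr0 : 0 < r := hsub hr
        have hξ : |(ξ : ℝ)| = 1 := norm_eq_of_mem_sphere ξ
        have hmem : r • (ξ : ℝ) ∈ {x | 1 / 2 ≤ |y * x| ∧ |y * x| ≤ 1} := by
          have : |y * (r • (ξ : ℝ))| = s * r := by
            rw [smul_eq_mul, abs_mul, abs_mul, hξ, abs_of_pos hr0, mul_one]
          rw [mem_ofPred_eq, this]
          constructor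
          · calc (1 : ℝ) / 2 = s * (1 / (2 * s)) := by field_simp
              _ ≤ s * r := by gcongr; exact hr.1
          · calc s * r ≤ s * (1 / s) := by gcongr; exact hr.2
              _ = 1 := by field_simp
        rw [indicator_of_mem hmem, Pi.one_apply, one_mul]
        exact ENNReal.ofReal_le_ofReal
          (lampertiRadial_lower_bound hα (abs_nonneg b) (hbm ξ) hy hr0 hr.2)
    _ ≤ _ := lintegral_mono_set hsub


/-! ### Decay of the characteristic function -/

theorem IsLampertiStable.exists_norm_charFun_le {α : ℝ} {f : Metric.sphere (0 : ℝ) 1 → ℝ}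
    {σ : Measure (Metric.sphere (0 : ℝ) 1)} {μ : Measure ℝ} (hμ : IsLampertiStable α f σ μ) :
    ∃ c C : ℝ, 0 < c ∧ ∀ y : ℝ, ‖charFun μ y‖ ≤ C * Real.exp (-c * |y| ^ α) := by
  have := hμ.finite
  obtain ⟨⟨hprob, -⟩, hν, θ, hθ⟩ := hμ.levy
  have hα := hμ.index_mem.1
  obtain ⟨c, hc, h⟩ := exists_le_lampertiLevyMeasure α hα f hμ.measurable σ hμ.ne_zero
  -- The factor `exp (c / 20)` absorbs the range `|y| ≤ 1`, where only `‖charFun μ y‖ ≤ 1` is used.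
  refine ⟨c / 20, Real.exp (c / 20), by positivity, fun y => ?_⟩
  rw [← Real.exp_add]
  rcases le_total 1 |y| with hy | hy
  · have h1 := (h y hy).trans (hν.measure_le_re_levyExponent θ y)
    have h2 : 0 < c * |y| ^ α := by positivity
    have h3 := (ENNReal.ofReal_le_ofReal_iff' (p := c * |y| ^ α)).1 h1
    -- `ENNReal.ofReal` truncates at zero, whence the alternative `c * |y| ^ α ≤ 0` in `h3`.
    rw [hθ, Complex.norm_exp, Complex.neg_re, Real.exp_le_exp]
    rcases h3 with h3 | h3 <;> linarith
  · refine (norm_charFun_le_one y).trans (Real.one_le_exp ?_)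
    have : |y| ^ α ≤ 1 := Real.rpow_le_one (abs_nonneg y) hy hα.le
    nlinarith

/-! ### Regularity of the density -/

theorem integrable_abs_pow_mul_exp_neg_mul_abs_rpow {α c : ℝ} (hα : 0 < α) (hc : 0 < c) (n : ℕ) :
    Integrable fun x : ℝ => |x| ^ n * Real.exp (-c * |x| ^ α) := by
  set g : ℝ → ℝ := fun x => |x| ^ n * Real.exp (-c * |x| ^ α) with hg
  have h : IntegrableOn g (Ioi 0) := by
    refine (integrableOn_rpow_mul_exp_neg_mul_rpow (s := n) (by
      linarith [Nat.cast_nonneg (α := ℝ) n]) hα hc).congr_fun (fun x hx => ?_) measurableSet_Ioi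
    simp [hg, abs_of_pos (mem_Ioi.1 hx)]
  have heven : (fun x => g (-x)) = g := by ext x; simp [hg]
  have h' : IntegrableOn g (Iio 0) := by
    rw [← neg_zero] at h
    simpa only [heven] using h.comp_neg_Iio
  rw [← integrableOn_univ, ← Iic_union_Ioi (a := (0 : ℝ)), integrableOn_union,
    integrableOn_Iic_iff_integrableOn_Iio]
  exact ⟨h', h⟩

open FourierTransform in
/-- If all moments of `G` are integrable, then `Re (𝓕 G)` is smooth and its derivatives vanish at
infinity; the derivatives of the real part are dominated by those of `𝓕 G`. -/
theorem contDiff_re_fourier_and_tendsto {G : ℝ → ℂ}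
    (hG : ∀ n : ℕ, Integrable fun t : ℝ => t ^ n • G t) :
    ContDiff ℝ ∞ (fun x => (𝓕 G x).re) ∧
      ∀ n : ℕ, Tendsto (iteratedDeriv n fun x => (𝓕 G x).re) (cocompact ℝ) (𝓝 0) := by
  have hs : ContDiff ℝ ∞ (𝓕 G) := Real.contDiff_fourier fun n _ => by
    simpa [norm_smul] using (hG n).norm
  refine ⟨Complex.reCLM.contDiff.comp hs, fun n => ?_⟩
  have hz : Tendsto (fun x => ‖iteratedDeriv n (𝓕 G) x‖) (cocompact ℝ) (𝓝 0) := by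
    rw [Real.iteratedDeriv_fourier (N := ⊤) (fun k _ => hG k) le_top]
    exact tendsto_zero_iff_norm_tendsto_zero.1 (Real.zero_at_infty_fourier _)
  refine squeeze_zero_norm (fun x => ?_) hz
  have := Complex.reCLM.norm_iteratedFDeriv_comp_left (x := x) hs.contDiffAt
    (n := n) (by exact_mod_cast le_top)
  rw [norm_iteratedFDeriv_eq_norm_iteratedDeriv, norm_iteratedFDeriv_eq_norm_iteratedDeriv,
    Complex.reCLM_norm, one_mul] at this
  exact this

theorem proposition3 (α : ℝ) (f : Metric.sphere (0 : ℝ) 1 → ℝ)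
    (σ : Measure (Metric.sphere (0 : ℝ) 1)) (μ : Measure ℝ)
    (hμ : IsLampertiStable α f σ μ) :
    ∃ p : ℝ → ℝ, ContDiff ℝ ∞ p ∧ (∀ x, 0 ≤ p x) ∧
      μ = volume.withDensity (fun x => ENNReal.ofReal (p x)) ∧
      ∀ n : ℕ, Tendsto (iteratedDeriv n p) (cocompact ℝ) (𝓝 0) := by
  have : IsProbabilityMeasure μ := hμ.levy.1.1
  obtain ⟨c, C, hc, h⟩ := hμ.exists_norm_charFun_le
  have hφ (n : ℕ) : Integrable fun y : ℝ => y ^ n • charFun μ y := by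
    refine ((integrable_abs_pow_mul_exp_neg_mul_abs_rpow hμ.index_mem.1 hc n).const_mul C).mono'
      (by fun_prop) (Eventually.of_forall fun y => ?_)
    rw [norm_smul, norm_pow, Real.norm_eq_abs, mul_left_comm]
    gcongr
    exact h y
  have h2pi : (2 * Real.pi) ≠ 0 := by positivity
  have hG (n : ℕ) : Integrable fun t : ℝ => t ^ n • charFun μ (2 * Real.pi * t) := by
    refine (((hφ n).comp_mul_left' h2pi).smul ((2 * Real.pi) ^ n)⁻¹).congr
      (Eventually.of_forall fun t => ?_)
    simp only [Pi.smul_apply, smul_smul, mul_pow]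
    congr 1
    field_simp
  obtain ⟨hs, ht⟩ := contDiff_re_fourier_and_tendsto hG
  obtain ⟨h0, hd⟩ := eq_withDensity_re_fourier_charFun μ (by simpa using hG 0)
  exact ⟨_, hs, h0, hd, ht⟩
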